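/- Let $p\ge 1$ be an integer and $N=2p$. For smooth functions $w_1,\dots,w_N,f:\mathbb R\to\mathbb R$ put $$\mathcal A_p[w_1,\dots,w_N](f)=\sum_{\sigma\in S_N}(-1)^\sigma\, w_{\sigma(1)}\partial_x^p\circ w_{\sigma(2)}\partial_x^p\circ\cdots\circ w_{\sigma(N)}\partial_x^p\,(f),$$ where $(-1)^\sigma$ is the sign of $\sigma$, and let $\mathrm{Wronsk}(w_1,\dots,w_N)=\det\bigl(\partial_x^{i-1}w_j\bigr)_{1\le i,j\le N}$. There is exactly one real number $\mathrm{const}(p)$ such that $$\mathcal A_p[w_1,\dots,w_N](f)=\mathrm{const}(p)\cdot\mathrm{Wronsk}(w_1,\dots,w_N)\cdot\partial_x^p f\qquad\text{for all smooth } w_1,\dots,w_N,f.$$ For $\sigma\in S_N$ and $1\le k\le N-1$ put $$T_k=\sum_{i=N-k+1}^{N}\bigl(\sigma(i)-1-p\bigr),\qquad E_k=\sum_{j=0}^{k-1}\bigl(\sigma(N-j)-1\bigr)-(k-1)p,$$ and let $\Phi_p$ be the set of all $\sigma\in S_N$ with $\sigma(1)=1$ and $T_k\ge 0$ for all $k=1,\dots,N-1$.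 For the monomial weights $w_n(x)=x^{n-1}$, $n=1,\dots,N$, the set $\Phi_p$ consists of exactly those $\sigma\in S_N$ for which the function $$w_{\sigma(1)}\,\partial_x^p\bigl(w_{\sigma(2)}\,\partial_x^p(\cdots\partial_x^p(w_{\sigma(N)})\cdots)\bigr)$$ does not vanish identically. Moreover, $$\mathrm{const}(p)\cdot\prod_{k=0}^{N-1}k!=\sum_{\sigma\in\Phi_p}(-1)^\sigma\prod_{k=1}^{N-1}E_k^{\underline p},$$ where $\alpha^{\underline p}=\alpha(\alpha-1)\cdots(\alpha-p+1)$ denotes the falling factorial. -/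

import Mathlib

open scoped ContDiff

/-- The composition `w₁ ∂ᵖ ∘ w₂ ∂ᵖ ∘ ⋯ ∘ wₙ ∂ᵖ` applied to `f`, for a list of weights
`[w₁, …, wₙ]`. -/
noncomputable def opComp (p : ℕ) : List (ℝ → ℝ) → (ℝ → ℝ) → (ℝ → ℝ)
  | [], f => f
  | w :: ws, f => fun x => w x * iteratedDeriv p (opComp p ws f) x

/-- The alternating composition
`∑ σ ∈ S_N, (-1)^σ w_{σ(1)} ∂ᵖ ∘ ⋯ ∘ w_{σ(N)} ∂ᵖ (f)`, where `N = 2p`. -/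
noncomputable def altComp (p : ℕ) (w : Fin (2 * p) → ℝ → ℝ) (f : ℝ → ℝ) : ℝ → ℝ := fun x =>
  ∑ σ : Equiv.Perm (Fin (2 * p)),
    ((Equiv.Perm.sign σ : ℤ) : ℝ) * opComp p (List.ofFn fun i => w (σ i)) f x

/-- The Wronskian determinant of `w₁, …, wₙ`. -/
noncomputable def wronskianDet {n : ℕ} (w : Fin n → ℝ → ℝ) : ℝ → ℝ := fun x =>
  (Matrix.of fun i j : Fin n => iteratedDeriv (i : ℕ) (w j) x).det

/-- `c` is a universal proportionality constant: for all smooth weights and all smooth `f`,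
the alternating composition equals `c` times the Wronskian times `∂ᵖ f`. -/
def IsAltConst (p : ℕ) (c : ℝ) : Prop :=
  ∀ (w : Fin (2 * p) → ℝ → ℝ) (f : ℝ → ℝ), (∀ i, ContDiff ℝ ∞ (w i)) → ContDiff ℝ ∞ f →
    ∀ x, altComp p w f x = c * wronskianDet w x * iteratedDeriv p f x

/-- The universal constant `const(p)`. -/
noncomputable def altConst (p : ℕ) : ℝ := Classical.epsilon (IsAltConst p)

/-- The nested expression `w₁ ∂ᵖ(w₂ ∂ᵖ(⋯ ∂ᵖ(wₙ)))`, in which the last weight is the function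
that is acted upon. -/
noncomputable def nestedComp (p : ℕ) : List (ℝ → ℝ) → (ℝ → ℝ)
  | [] => fun _ => 1
  | [w] => w
  | w :: v :: ws => fun x => w x * iteratedDeriv p (nestedComp p (v :: ws)) x

/-- The monomial weights `1, x, …, x^{N-1}`, where `N = 2p`. -/
def monomialWeight (p : ℕ) (i : Fin (2 * p)) : ℝ → ℝ := fun x => x ^ (i : ℕ)

/-- The partial sum `T_k = ∑_{i=N-k+1}^{N} (σ(i) - 1 - p)`, where `N = 2p`. Positions and values
are counted from `0` here, so that the value `σ i` stands for `σ(i+1) - 1`. -/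
def partialSum (p : ℕ) (σ : Equiv.Perm (Fin (2 * p))) (k : ℕ) : ℤ :=
  ∑ i ∈ Finset.univ.filter (fun i : Fin (2 * p) => 2 * p - k ≤ (i : ℕ)), (((σ i : ℕ) : ℤ) - (p : ℤ))

/-- The running exponent `E_k = ∑_{j=0}^{k-1} (σ(N-j) - 1) - (k-1) p`, where `N = 2p`;
the position `N - j`, counted from `1`, is `Fin.rev j`, counted from `0`. -/
def runningExp (p : ℕ) (σ : Equiv.Perm (Fin (2 * p))) (k : ℕ) : ℤ :=
  (∑ j ∈ Finset.univ.filter (fun j : Fin (2 * p) => (j : ℕ) < k), ((σ (Fin.rev j) : ℕ) : ℤ)) -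
    ((k : ℤ) - 1) * (p : ℤ)

/-- The filter: `σ(1) = 1` and `T_k ≥ 0` for `k = 1, …, N - 1`, where `N = 2p`. -/
def IsSurviving (p : ℕ) (σ : Equiv.Perm (Fin (2 * p))) : Prop :=
  (∀ i : Fin (2 * p), (i : ℕ) = 0 → (σ i : ℕ) = 0) ∧
    ∀ k ∈ Finset.Icc (1 : ℕ) (2 * p - 1), 0 ≤ partialSum p σ k

instance instDecidableIsSurviving (p : ℕ) (σ : Equiv.Perm (Fin (2 * p))) : Decidable (IsSurviving p σ) :=
  inferInstanceAs (Decidable (_ ∧ _))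

/-- The set `Φ_p` of the permutations of `{1, …, 2p}` that pass the filter. -/
def survivingPerms (p : ℕ) : Finset (Equiv.Perm (Fin (2 * p))) :=
  Finset.univ.filter fun σ => IsSurviving p σ

/-! By Leibniz, the composition is a combination of monomials `∏ ∂^{a i} w_i * ∂^b f` of total order
`2p * p`, with `b ≥ p` because the innermost operator differentiates `f`
(`iteratedDeriv_opComp_mem_diffSpan`). Antisymmetrization turns the product into a determinant,
which vanishes unless the `a i` are distinct, hence of sum at least `0 + ⋯ + (2p - 1) = 2p * p - p`.
So only `b = p` with `a` a permutation of `0, …, 2p - 1` remains, a signed Wronskian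
(`sum_sign_mul_prod_iteratedDeriv`). Testing on monomial weights, `f = x^p / p!` and `x = 0`
computes the constant, and since the Wronskian is nonzero there, also gives uniqueness. -/

/-! ### Existence of the constant. -/

theorem opComp_contDiff (p : ℕ) (ws : List (ℝ → ℝ)) (f : ℝ → ℝ)
    (hws : ∀ w ∈ ws, ContDiff ℝ ∞ w) (hf : ContDiff ℝ ∞ f) : ContDiff ℝ ∞ (opComp p ws f) := by
  induction ws with
  | nil => exact hf
  | cons w ws ih =>
    have h1 := ih fun v hv => hws v (List.mem_cons_of_mem _ hv)
    have h2 : ContDiff ℝ ∞ (iteratedDeriv p (opComp p ws f)) := by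
      rw [iteratedDeriv_eq_iterate]
      exact ContDiff.iterate_deriv p h1
    exact (hws w List.mem_cons_self).mul h2

/-- A tuple of `n` smooth weights, a smooth argument, and a point of evaluation. -/
abbrev SmoothData (n : ℕ) : Type :=
  (Fin n → {g : ℝ → ℝ // ContDiff ℝ ∞ g}) × {g : ℝ → ℝ // ContDiff ℝ ∞ g} × ℝ

/-- The differential monomial `∏ i, ∂^{a i} w_i * ∂^b f`. -/
noncomputable def diffMonomial {n : ℕ} (a : Fin n → ℕ) (b : ℕ) : SmoothData n → ℝ := fun d =>
  (∏ i, iteratedDeriv (a i) (d.1 i).1 d.2.2) * iteratedDeriv b d.2.1.1 d.2.2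

/-- The span of the differential monomials of total order `s` in which the argument is
differentiated at least `p` times (if `p ≤ s`). -/
def diffSpan (n p s : ℕ) : Submodule ℝ (SmoothData n → ℝ) :=
  Submodule.span ℝ {F | ∃ (a : Fin n → ℕ) (b : ℕ),
    ∑ i, a i + b = s ∧ (p ≤ s → p ≤ b) ∧ F = diffMonomial a b}

theorem iteratedDeriv_mul_mem_diffSpan {n p s : ℕ} (i : ℕ) (hs : p ≤ s)
    {F : SmoothData n → ℝ} (hF : F ∈ diffSpan n p s) :
    (fun d : SmoothData (n + 1) =>
      iteratedDeriv i (d.1 0).1 d.2.2 * F (fun j => d.1 j.succ, d.2)) ∈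
      diffSpan (n + 1) p (i + s) := by
  induction hF using Submodule.span_induction with
  | mem F hF =>
    obtain ⟨a, b, hab, hb, rfl⟩ := hF
    refine Submodule.subset_span ⟨Fin.cons i a, b, ?_, fun _ => hb hs, ?_⟩
    · simp [Fin.sum_univ_succ, ← hab, add_assoc]
    · funext d
      simp [diffMonomial, Fin.prod_univ_succ, mul_assoc]
  | zero =>
    convert Submodule.zero_mem (diffSpan (n + 1) p (i + s)) using 1
    funext d
    simp
  | add F G _ _ hF hG =>
    convert Submodule.add_mem _ hF hG using 1
    funext d
    simp [mul_add]
  | smul c F _ hF =>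
    convert Submodule.smul_mem _ c hF using 1
    funext d
    simp only [Pi.smul_apply, smul_eq_mul]
    ring

theorem iteratedDeriv_opComp_mem_diffSpan (p n m : ℕ) :
    (fun d : SmoothData n =>
      iteratedDeriv m (opComp p (List.ofFn fun i => (d.1 i).1) d.2.1.1) d.2.2) ∈
      diffSpan n p (n * p + m) := by
  induction n generalizing m with
  | zero =>
    -- With no weights the order of `f` is `m`, possibly below `p`; hence the guard `p ≤ s` in
    -- `diffSpan`.
    refine Submodule.subset_span ⟨Fin.elim0, m, by simp, by simp, ?_⟩
    funext d
    simp [diffMonomial, opComp]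
  | succ n ih =>
    have key : (fun d : SmoothData (n + 1) =>
        iteratedDeriv m (opComp p (List.ofFn fun i => (d.1 i).1) d.2.1.1) d.2.2) =
        ∑ i ∈ Finset.range (m + 1), (m.choose i : ℝ) • fun d : SmoothData (n + 1) =>
          iteratedDeriv i (d.1 0).1 d.2.2 * iteratedDeriv (m - i + p)
            (opComp p (List.ofFn fun j : Fin n => (d.1 j.succ).1) d.2.1.1) d.2.2 := by
      funext d
      have h1 : ContDiff ℝ ∞ (opComp p (List.ofFn fun j : Fin n => (d.1 j.succ).1) d.2.1.1) := by
        refine opComp_contDiff _ _ _ (fun w hw => ?_) d.2.1.2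
        obtain ⟨j, rfl⟩ := (List.mem_ofFn' _ _).1 hw
        exact (d.1 j.succ).2
      have h2 := ContDiff.iterate_deriv p h1
      rw [List.ofFn_succ]
      have h3 := iteratedDeriv_mul (n := m) (x := d.2.2)
        ((d.1 0).2.of_le (by exact_mod_cast le_top)).contDiffAt
        ((h2.of_le (m := m) (by exact_mod_cast le_top)).contDiffAt)
      rw [← iteratedDeriv_eq_iterate] at h3
      refine h3.trans ?_
      rw [Finset.sum_apply]
      refine Finset.sum_congr rfl fun i _ => ?_
      simp only [Pi.smul_apply, smul_eq_mul, iteratedDeriv_eq_iterate, Function.iterate_add_apply,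
        mul_assoc]
    rw [key]
    refine Submodule.sum_mem _ fun i hi => Submodule.smul_mem _ _ ?_
    have h4 := iteratedDeriv_mul_mem_diffSpan i (by omega) (ih (m - i + p))
    convert h4 using 2
    have := Finset.mem_range.1 hi
    rw [Nat.succ_mul]
    omega

/-- Exchange argument: `s` has as many elements `≥ n` as it misses below `n`, so any exchange
strictly increases the sum. -/
theorem range_eq_of_sum_le {s : Finset ℕ} {n : ℕ} (hs : s.card = n)
    (h : ∑ i ∈ s, i ≤ ∑ i ∈ Finset.range n, i) : s = Finset.range n := by
  have hcard : (s \ Finset.range n).card = (Finset.range n \ s).card :=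
    Finset.card_sdiff_comm (by simp [hs])
  have h1 := Finset.sum_inter_add_sum_sdiff s (Finset.range n) (fun i => i)
  have h2 := Finset.sum_inter_add_sum_sdiff (Finset.range n) s (fun i => i)
  rw [Finset.inter_comm] at h2
  have h3 : (s \ Finset.range n).card * n ≤ ∑ i ∈ s \ Finset.range n, i := by
    rw [← smul_eq_mul]
    exact Finset.card_nsmul_le_sum _ _ _ fun i hi => by simp at hi; exact hi.2
  have h4 : ∑ i ∈ Finset.range n \ s, (i + 1) ≤ (Finset.range n \ s).card * n := by
    rw [← smul_eq_mul]
    exact Finset.sum_le_card_nsmul _ _ _ fun i hi => by simp at hi; exact hi.1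
  rw [Finset.sum_add_distrib, ← Finset.card_eq_sum_ones] at h4
  rw [hcard] at h3
  have h5 : (s \ Finset.range n).card = 0 := by omega
  rw [Finset.card_eq_zero, Finset.sdiff_eq_empty_iff_subset] at h5
  exact Finset.eq_of_subset_of_card_le h5 (by simp [hs])

theorem sum_sign_mul_prod_iteratedDeriv {n : ℕ} (a : Fin n → ℕ)
    (ha : ∑ i, a i ≤ ∑ i ∈ Finset.range n, i) :
    ∃ c : ℝ, (¬ ∑ i, a i = ∑ i ∈ Finset.range n, i → c = 0) ∧ ∀ (w : Fin n → ℝ → ℝ) (x : ℝ),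
      ∑ σ : Equiv.Perm (Fin n), ((Equiv.Perm.sign σ : ℤ) : ℝ) *
        ∏ i, iteratedDeriv (a i) (w (σ i)) x = c * wronskianDet w x := by
  have hdet : ∀ (w : Fin n → ℝ → ℝ) (x : ℝ), ∑ σ : Equiv.Perm (Fin n),
      ((Equiv.Perm.sign σ : ℤ) : ℝ) * ∏ i, iteratedDeriv (a i) (w (σ i)) x =
      (Matrix.of fun i j : Fin n => iteratedDeriv (a i) (w j) x).det := fun w x => by
    rw [← Matrix.det_transpose, Matrix.det_apply']
    rfl
  by_cases hinj : Function.Injective a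
  · have himg : Finset.univ.image a = Finset.range n := by
      apply range_eq_of_sum_le
      · simp [Finset.card_image_of_injective _ hinj]
      · rwa [Finset.sum_image hinj.injOn]
    have hlt : ∀ i, a i < n := fun i => by
      rw [← Finset.mem_range, ← himg]
      exact Finset.mem_image_of_mem _ (Finset.mem_univ i)
    let τ : Equiv.Perm (Fin n) := Equiv.ofBijective (fun i => ⟨a i, hlt i⟩)
      (Finite.injective_iff_bijective.1 fun i j h => hinj (by simpa using h))
    refine ⟨((Equiv.Perm.sign τ : ℤ) : ℝ), fun h => absurd ?_ h, fun w x => ?_⟩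
    · rw [← himg, Finset.sum_image hinj.injOn]
    · rw [hdet, wronskianDet, ← Matrix.det_permute]
      rfl
  · refine ⟨0, fun _ => rfl, fun w x => ?_⟩
    rw [hdet, zero_mul]
    obtain ⟨i, j, hij, hne⟩ := by simpa [Function.Injective] using hinj
    exact Matrix.det_zero_of_row_eq hne (by funext k; simp [hij])

theorem exists_isAltConst (p : ℕ) (hp : 1 ≤ p) : ∃ c, IsAltConst p c := by
  have key : ∀ F ∈ diffSpan (2 * p) p (2 * p * p + 0), ∃ c : ℝ, ∀ d : SmoothData (2 * p),
      ∑ σ : Equiv.Perm (Fin (2 * p)), ((Equiv.Perm.sign σ : ℤ) : ℝ) *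
        F (fun i => d.1 (σ i), d.2) =
      c * wronskianDet (fun i => (d.1 i).1) d.2.2 * iteratedDeriv p d.2.1.1 d.2.2 := by
    intro F hF
    induction hF using Submodule.span_induction with
    | mem F hF =>
      obtain ⟨a, b, hab, hb, rfl⟩ := hF
      have hb : p ≤ b := hb (by nlinarith)
      have hN : ∑ i ∈ Finset.range (2 * p), i + p = 2 * p * p := by
        have := Finset.sum_range_id_mul_two (2 * p)
        obtain ⟨q, rfl⟩ : ∃ q, p = q + 1 := ⟨p - 1, by omega⟩
        have e : 2 * (q + 1) - 1 = 2 * q + 1 := by omega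
        rw [e] at this
        nlinarith
      -- `b ≥ p` bounds the sum of the `a i`; if the inequality is strict then `c = 0`, otherwise `b
      -- = p`.
      obtain ⟨c, hc0, hc⟩ := sum_sign_mul_prod_iteratedDeriv a (by omega)
      refine ⟨c, fun d => ?_⟩
      simp only [diffMonomial, ← mul_assoc]
      rw [← Finset.sum_mul, hc (fun i => (d.1 i).1) d.2.2]
      by_cases h : ∑ i, a i = ∑ i ∈ Finset.range (2 * p), i
      · rw [show b = p by omega]
      · simp [hc0 h]
    | zero => exact ⟨0, by simp⟩
    | add F G _ _ hF hG =>
      obtain ⟨c, hc⟩ := hF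
      obtain ⟨c', hc'⟩ := hG
      refine ⟨c + c', fun d => ?_⟩
      simp only [Pi.add_apply, mul_add, Finset.sum_add_distrib, hc, hc']
      ring
    | smul r F _ hF =>
      obtain ⟨c, hc⟩ := hF
      refine ⟨r * c, fun d => ?_⟩
      simp only [Pi.smul_apply, smul_eq_mul, mul_left_comm _ r, ← Finset.mul_sum, hc]
      ring
  obtain ⟨c, hc⟩ := key _ (iteratedDeriv_opComp_mem_diffSpan p (2 * p) 0)
  refine ⟨c, fun w f hw hf x => ?_⟩
  have := hc (fun i => ⟨w i, hw i⟩, ⟨f, hf⟩, x)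
  simpa only [iteratedDeriv_zero, altComp] using this

/-! ### Nested compositions of monomials. -/

/-- The exponent reached after the last `k` weights `x ^ e i` have been processed. -/
def partialExp (p : ℕ) {n : ℕ} (e : Fin n → ℕ) (k : ℕ) : ℤ :=
  (∑ j ∈ Finset.univ.filter (fun j : Fin n => (j : ℕ) < k), (e (Fin.rev j) : ℤ)) -
    ((k : ℤ) - 1) * (p : ℤ)

theorem partialExp_tail (p : ℕ) {n k : ℕ} (e : Fin (n + 1) → ℕ) (hk : k ≤ n) :
    partialExp p (fun i : Fin n => e i.succ) k = partialExp p e k := by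
  unfold partialExp
  congr 1
  rw [Finset.sum_filter, Finset.sum_filter, Fin.sum_univ_castSucc]
  simp [Fin.rev_castSucc, hk]

theorem partialExp_succ (p : ℕ) {n : ℕ} (e : Fin (n + 1) → ℕ) :
    partialExp p e (n + 1) = partialExp p (fun i : Fin n => e i.succ) n + e 0 - p := by
  unfold partialExp
  rw [Finset.sum_filter, Finset.sum_filter, Fin.sum_univ_castSucc]
  simp only [Fin.rev_castSucc, Fin.rev_last, Fin.val_castSucc, Fin.val_last, Fin.is_lt,
    Nat.lt_succ_of_lt, Nat.lt_succ_self, if_true]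
  push_cast
  ring

/-- Each `∂^p` sends `x^E` to a falling factorial times `x^(E - p)`, and to zero exactly when `E <
p`. Only `k ≤ n` is constrained, since no derivative follows the outermost weight. -/
theorem nestedComp_pow (p n : ℕ) (e : Fin (n + 1) → ℕ) :
    ((∀ k ∈ Finset.Icc 1 n, (p : ℤ) ≤ partialExp p e k) →
      0 ≤ partialExp p e (n + 1) ∧
      nestedComp p (List.ofFn fun i => fun x : ℝ => x ^ e i) = fun x =>
        (∏ k ∈ Finset.Icc 1 n, (((descPochhammer ℤ p).eval (partialExp p e k) : ℤ) : ℝ)) *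
          x ^ (partialExp p e (n + 1)).toNat) ∧
    ((¬ ∀ k ∈ Finset.Icc 1 n, (p : ℤ) ≤ partialExp p e k) →
      nestedComp p (List.ofFn fun i => fun x : ℝ => x ^ e i) = fun _ => 0) := by
  induction n with
  | zero =>
    have h0 : partialExp p e 1 = e 0 := by simp [partialExp]
    simp [h0, nestedComp]
  | succ n ih =>
    have hrec : nestedComp p (List.ofFn fun i => fun x : ℝ => x ^ e i) = fun x =>
        x ^ e 0 * iteratedDeriv p
          (nestedComp p (List.ofFn fun i : Fin (n + 1) => fun x : ℝ => x ^ e i.succ)) x := by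
      rw [List.ofFn_succ, List.ofFn_succ]
      rfl
    have htail : ∀ k ∈ Finset.Icc 1 n,
        partialExp p (fun i : Fin (n + 1) => e i.succ) k = partialExp p e k := fun k hk =>
      partialExp_tail p e (by have := Finset.mem_Icc.1 hk; omega)
    obtain ⟨ih1, ih2⟩ := ih fun i => e i.succ
    have hIcc : (∀ k ∈ Finset.Icc 1 (n + 1), (p : ℤ) ≤ partialExp p e k) ↔
        (∀ k ∈ Finset.Icc 1 n, (p : ℤ) ≤ partialExp p (fun i : Fin (n + 1) => e i.succ) k) ∧
          (p : ℤ) ≤ partialExp p e (n + 1) := by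
      rw [← Finset.insert_Icc_right_eq_Icc_add_one (by omega), Finset.forall_mem_insert, and_comm]
      refine and_congr_left' (forall₂_congr fun k hk => by rw [htail k hk])
    rw [hIcc, hrec]
    by_cases h : ∀ k ∈ Finset.Icc 1 n, (p : ℤ) ≤ partialExp p (fun i : Fin (n + 1) => e i.succ) k
    · obtain ⟨hE0, hE⟩ := ih1 h
      rw [hE, Finset.prod_congr rfl fun k hk => by rw [htail k hk]]
      have hEe := partialExp_tail p e (le_refl (n + 1))
      rw [hEe] at hE0 ⊢
      obtain ⟨E, hEE⟩ := Int.eq_ofNat_of_zero_le hE0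
      have hs := partialExp_succ p e
      rw [hEe] at hs
      simp only [iteratedDeriv_const_mul_field, iteratedDeriv_pow, hEE, Int.toNat_natCast]
      refine ⟨fun ⟨_, hp⟩ => ⟨by omega, ?_⟩, fun hn => ?_⟩
      · rw [← Finset.insert_Icc_right_eq_Icc_add_one (by omega), Finset.prod_insert (by simp), hEE,
          descPochhammer_eval_eq_descFactorial,
          show (partialExp p e (n + 1 + 1)).toNat = e 0 + (E - p) by omega]
        funext x
        push_cast
        ring
      · have : E < p := by
          by_contra hc
          exact hn ⟨h, by omega⟩
        simp [Nat.descFactorial_eq_zero_iff_lt.2 this]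
    · rw [ih2 h]
      exact ⟨fun hn => absurd hn.1 h, fun _ => by simp⟩

theorem opComp_eq_nestedComp {p : ℕ} {f : ℝ → ℝ} (hf : iteratedDeriv p f = fun _ => 1)
    (w : ℝ → ℝ) (ws : List (ℝ → ℝ)) : opComp p (w :: ws) f = nestedComp p (w :: ws) := by
  induction ws generalizing w with
  | nil => simp [opComp, nestedComp, hf]
  | cons v ws ih => rw [opComp, ih, nestedComp]

theorem partialSum_eq (p : ℕ) (σ : Equiv.Perm (Fin (2 * p))) {k : ℕ} (hk : k ≤ 2 * p) :
    partialSum p σ k = runningExp p σ k - p := by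
  unfold partialSum runningExp
  have h1 : ∑ i ∈ Finset.univ.filter (fun i : Fin (2 * p) => 2 * p - k ≤ (i : ℕ)),
      (((σ i : ℕ) : ℤ) - (p : ℤ)) =
      ∑ j ∈ Finset.univ.filter (fun j : Fin (2 * p) => (j : ℕ) < k),
        (((σ (Fin.rev j) : ℕ) : ℤ) - (p : ℤ)) := by
    rw [Finset.sum_filter, Finset.sum_filter, ← Equiv.sum_comp Fin.revPerm]
    refine Finset.sum_congr rfl fun j _ => ?_
    have : (2 * p - k ≤ ((Fin.revPerm j : Fin (2 * p)) : ℕ)) ↔ (j : ℕ) < k := by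
      rw [Fin.revPerm_apply, Fin.val_rev]
      omega
    simp only [this]
    rfl
  rw [h1, Finset.sum_sub_distrib, Finset.sum_const, Fin.card_filter_val_lt, min_eq_right hk,
    nsmul_eq_mul]
  ring

theorem runningExp_two_mul (p : ℕ) (σ : Equiv.Perm (Fin (2 * p))) :
    runningExp p σ (2 * p) = 0 := by
  unfold runningExp
  rw [Finset.filter_true_of_mem fun j _ => j.2]
  have h1 : ∑ j, ((σ (Fin.rev j) : ℕ) : ℤ) = ∑ j : Fin (2 * p), ((j : ℕ) : ℤ) :=
    (Equiv.sum_comp Fin.revPerm fun j => ((σ j : ℕ) : ℤ)).trans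
      (Equiv.sum_comp σ fun j => ((j : ℕ) : ℤ))
  have h := Fin.sum_univ_eq_sum_range (fun i => (i : ℤ)) (2 * p)
  rw [h1, h]
  have h2 := Finset.sum_range_id_mul_two (2 * p)
  rcases p with _ | q
  · simp
  · rw [show 2 * (q + 1) - 1 = 2 * q + 1 by omega] at h2
    zify at h2
    push_cast at h2 ⊢
    linarith

/-- The condition on the first value is automatic: the final exponent is `0`, and the one before it
is at least `p`, so the outermost weight has exponent `0`. -/
theorem isSurviving_iff (p : ℕ) (hp : 1 ≤ p) (σ : Equiv.Perm (Fin (2 * p))) :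
    IsSurviving p σ ↔ ∀ k ∈ Finset.Icc (1 : ℕ) (2 * p - 1), (p : ℤ) ≤ runningExp p σ k := by
  have hT : ∀ k ∈ Finset.Icc (1 : ℕ) (2 * p - 1),
      (0 ≤ partialSum p σ k ↔ (p : ℤ) ≤ runningExp p σ k) := fun k hk => by
    rw [partialSum_eq p σ (by have := Finset.mem_Icc.1 hk; omega)]
    omega
  unfold IsSurviving
  rw [forall₂_congr hT, and_iff_right_iff_imp]
  intro h i hi
  have h1 := h (2 * p - 1) (by simp; omega)
  have h2 := runningExp_two_mul p σ
  have h3 : runningExp p σ (2 * p) = runningExp p σ (2 * p - 1) + (σ i : ℕ) - p := by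
    unfold runningExp
    have : Finset.univ.filter (fun j : Fin (2 * p) => (j : ℕ) < 2 * p) =
        insert (Fin.rev i) (Finset.univ.filter fun j : Fin (2 * p) => (j : ℕ) < 2 * p - 1) := by
      ext j
      simp [Fin.ext_iff, Fin.val_rev]
      omega
    rw [this, Finset.sum_insert (by simp [Fin.val_rev]; omega), Fin.rev_rev,
      Nat.cast_sub (by omega)]
    push_cast
    ring
  omega

theorem nestedComp_monomialWeight (p : ℕ) (hp : 1 ≤ p) (σ : Equiv.Perm (Fin (2 * p))) :
    nestedComp p (List.ofFn fun i => monomialWeight p (σ i)) = fun _ =>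
      if σ ∈ survivingPerms p then ∏ k ∈ Finset.Icc 1 (2 * p - 1),
        (((descPochhammer ℤ p).eval (runningExp p σ k) : ℤ) : ℝ) else 0 := by
  have gen : ∀ N (e : Fin N → ℕ), 1 ≤ N → partialExp p e N = 0 →
      nestedComp p (List.ofFn fun i => fun x : ℝ => x ^ e i) = fun _ =>
        if ∀ k ∈ Finset.Icc 1 (N - 1), (p : ℤ) ≤ partialExp p e k then
          ∏ k ∈ Finset.Icc 1 (N - 1),
            (((descPochhammer ℤ p).eval (partialExp p e k) : ℤ) : ℝ) else 0 := by
    rintro (_ | n) e hN h0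
    · omega
    · rw [Nat.add_sub_cancel]
      split_ifs with h
      · rw [((nestedComp_pow p n e).1 h).2, h0]
        simp
      · exact (nestedComp_pow p n e).2 h
  have := gen (2 * p) (fun i => σ i) (by omega) (runningExp_two_mul p σ)
  simp only [survivingPerms, Finset.mem_filter, Finset.mem_univ, true_and, isSurviving_iff p hp]
  exact this

theorem prod_descPochhammer_runningExp_ne_zero (p : ℕ) (hp : 1 ≤ p)
    {σ : Equiv.Perm (Fin (2 * p))} (hσ : σ ∈ survivingPerms p) :
    ∏ k ∈ Finset.Icc 1 (2 * p - 1),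
      (((descPochhammer ℤ p).eval (runningExp p σ k) : ℤ) : ℝ) ≠ 0 := by
  simp only [survivingPerms, Finset.mem_filter, Finset.mem_univ, true_and,
    isSurviving_iff p hp] at hσ
  refine Finset.prod_ne_zero_iff.2 fun k hk => ?_
  have h := hσ k hk
  obtain ⟨E, hE⟩ := Int.eq_ofNat_of_zero_le (show 0 ≤ runningExp p σ k by omega)
  rw [hE, descPochhammer_eval_eq_descFactorial]
  have : E.descFactorial p ≠ 0 := by
    rw [Ne, Nat.descFactorial_eq_zero_iff_lt]
    omega
  exact_mod_cast this

/-! ### Evaluation and uniqueness of the constant. -/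

theorem wronskianDet_monomialWeight (p : ℕ) :
    wronskianDet (monomialWeight p) 0 = ∏ k ∈ Finset.range (2 * p), (Nat.factorial k : ℝ) := by
  rw [wronskianDet, ← Fin.prod_univ_eq_prod_range (fun k => (Nat.factorial k : ℝ)) (2 * p),
    ← Matrix.det_diagonal]
  congr 1
  ext i j
  simp only [Matrix.of_apply, Matrix.diagonal_apply]
  refine iteratedDeriv_fun_pow_zero.trans ?_
  by_cases h : i = j
  · simp [h]
  · simp [h, Fin.val_inj]

theorem IsAltConst.mul_prod_factorial {p : ℕ} (hp : 1 ≤ p) {c : ℝ} (hc : IsAltConst p c) :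
    c * ∏ k ∈ Finset.range (2 * p), (Nat.factorial k : ℝ) =
      ∑ σ ∈ survivingPerms p, ((Equiv.Perm.sign σ : ℤ) : ℝ) *
        ∏ k ∈ Finset.Icc 1 (2 * p - 1),
          (((descPochhammer ℤ p).eval (runningExp p σ k) : ℤ) : ℝ) := by
  -- With `∂^p f = 1` the innermost operator returns its own weight, so `opComp` becomes
  -- `nestedComp`.
  have hf : iteratedDeriv p (fun x : ℝ => (p.factorial : ℝ)⁻¹ * x ^ p) = fun _ => 1 := by
    funext x
    rw [iteratedDeriv_const_mul_field, iteratedDeriv_pow, Nat.descFactorial_self]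
    have := Nat.factorial_ne_zero p
    simp [this]
  have h := hc (monomialWeight p) (fun x => (p.factorial : ℝ)⁻¹ * x ^ p)
    (fun i => contDiff_id.pow _) (contDiff_const.mul (contDiff_id.pow _)) 0
  rw [hf, wronskianDet_monomialWeight, mul_one] at h
  rw [← h, altComp, ← Finset.sum_subset (Finset.subset_univ (survivingPerms p))]
  all_goals
    have hnest : ∀ σ : Equiv.Perm (Fin (2 * p)),
        opComp p (List.ofFn fun i => monomialWeight p (σ i))
          (fun x => (p.factorial : ℝ)⁻¹ * x ^ p) =
        nestedComp p (List.ofFn fun i => monomialWeight p (σ i)) := fun σ => by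
      rcases hL : List.ofFn fun i => monomialWeight p (σ i) with _ | ⟨w, ws⟩
      · have := congrArg List.length hL
        simp at this
        omega
      · exact opComp_eq_nestedComp hf w ws
  · refine Finset.sum_congr rfl fun σ hσ => ?_
    rw [hnest, nestedComp_monomialWeight p hp]
    simp [hσ]
  · intro σ _ hσ
    rw [hnest, nestedComp_monomialWeight p hp]
    simp [hσ]

theorem claim1 (p : ℕ) (hp : 1 ≤ p) :
    (∀ c : ℝ, IsAltConst p c ↔ c = altConst p) ∧
    (∀ σ : Equiv.Perm (Fin (2 * p)), σ ∈ survivingPerms p ↔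
      ∃ x : ℝ, nestedComp p (List.ofFn fun i => monomialWeight p (σ i)) x ≠ 0) ∧
    altConst p * ∏ k ∈ Finset.range (2 * p), (Nat.factorial k : ℝ) =
      ∑ σ ∈ survivingPerms p, ((Equiv.Perm.sign σ : ℤ) : ℝ) *
        ∏ k ∈ Finset.Icc 1 (2 * p - 1),
          (((descPochhammer ℤ p).eval (runningExp p σ k) : ℤ) : ℝ) := by
  have hspec : IsAltConst p (altConst p) := Classical.epsilon_spec (exists_isAltConst p hp)
  refine ⟨fun c => ⟨fun hc => ?_, fun hc => hc ▸ hspec⟩, fun σ => ?_,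
    hspec.mul_prod_factorial hp⟩
  · have hne : ∏ k ∈ Finset.range (2 * p), (Nat.factorial k : ℝ) ≠ 0 :=
      Finset.prod_ne_zero_iff.2 fun k _ => by exact_mod_cast Nat.factorial_ne_zero k
    exact mul_right_cancel₀ hne
      ((hc.mul_prod_factorial hp).trans (hspec.mul_prod_factorial hp).symm)
  · rw [nestedComp_monomialWeight p hp]
    by_cases hσ : σ ∈ survivingPerms p
    · simpa only [hσ, if_true, true_iff] using
        ⟨0, prod_descPochhammer_runningExp_ne_zero p hp hσ⟩
    · simp [hσ]
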